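/- Let $Z(t)=m+Y(t)$, $t\ge 0$, where $m\in\mathbb C$ and $Y=Y_1+iY_2$ is the stationary complex Ornstein--Uhlenbeck process with damping parameter $\lambda>0$ and frequency $\omega$, normalized to unit variances; that is, $(Y_1,Y_2)^\top$ is the centered Gaussian process with $$\mathsf E\begin{bmatrix}Y_1(t+\tau)\\Y_2(t+\tau)\end{bmatrix}\begin{bmatrix}Y_1(t)\\Y_2(t)\end{bmatrix}^{\top}=e^{-\lambda\tau}\begin{bmatrix}\cos(\omega\tau)&-\sin(\omega\tau)\\ \sin(\omega\tau)&\cos(\omega\tau)\end{bmatrix},\qquad t,\tau\ge 0.$$ Let $n\ge 2$. An admissible design is a choice of $n$ points $0\le t_1<t_2<\dots<t_n$; put $d_j:=t_{j+1}-t_j$, $1\le j\le n-1$. Let $C$ be the $2n\times 2n$ covariance matrix of the observations $\big(\mathrm{Re}\,Z(t_j),\mathrm{Im}\,Z(t_j)\big)$, $j=1,\dots,n$, and, for $\alpha,\beta\in\{\lambda,\omega\}$, $$\mathcal I_{\alpha,\beta}:=\tfrac12\,\mathrm{tr}\Big\{C^{-1}\frac{\partial C}{\partial\alpha}C^{-1}\frac{\partial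 C}{\partial\beta}\Big\},\qquad \mathcal I_\lambda:=\mathcal I_{\lambda,\lambda},\quad \mathcal I_\omega:=\mathcal I_{\omega,\omega},$$ the entries of the Fisher information matrix $\begin{bmatrix}\mathcal I_\lambda&\mathcal I_{\lambda,\omega}\\ \mathcal I_{\lambda,\omega}&\mathcal I_\omega\end{bmatrix}$ on $(\lambda,\omega)$. Assume $\omega\neq 0$. Among all admissible $n$-point designs: (a) no design maximizes $\mathcal I_\lambda$; that is, there is no admissible D-optimal design for the damping parameter $\lambda$; (b) a design maximizes $\mathcal I_\omega$ if and only if it is equidistant with $$d_1=\dots=d_{n-1}=\frac1\lambda\Big(\frac{W(-2e^{-2})}2+1\Big)\approx\frac{0.7968}{\lambda},$$ where $W$ is the principal branch of the Lambert $W$-function, i.e. $W(x)$ is the solution $w\ge -1$ of $we^w=x$ for $x\ge -1/e$; (c) the equation $1-d-2de^{-2d}-e^{-4d}=0$ has exactly one positive solution $d^\circ\approx 0.4930$, and a design maximizes the determinant of the Fisher information matrix on $(\lambda,\omega)$ if and only if it is equidistant with $d_1=\dots=d_{n-1}=d^\circ/\lambda$. Both decimal approximations (of $W(-2e^{-2})/2+1$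 and of $d^\circ$) are correct to within $5\cdot 10^{-5}$. -/

import Mathlib

open MeasureTheory ProbabilityTheory
open scoped NNReal

namespace ComplexOU

/-- The two real coordinates of a complex number: index `0` is the real part, index `1` the
imaginary part. -/
noncomputable def coord (a : Fin 2) (z : ℂ) : ℝ := ![z.re, z.im] a

/-- The matrix covariance function `R(τ) = σ² / (2 lam) * exp (τ A)`, with
`A = !![-lam, -om; om, -lam]`, of the two-dimensional stationary Ornstein-Uhlenbeck process with
damping `lam`, frequency `om` and diffusion coefficient `σ`. The matrix exponential is written as
`exp (-lam τ)` times the rotation by the angle `om τ`. -/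
noncomputable def covFun (lam om σ τ : ℝ) : Matrix (Fin 2) (Fin 2) ℝ :=
  (σ ^ 2 / (2 * lam) * Real.exp (-lam * τ)) •
    !![Real.cos (om * τ), -Real.sin (om * τ); Real.sin (om * τ), Real.cos (om * τ)]

/-- `Y` has, under `μ`, the law of the stationary complex Ornstein-Uhlenbeck process
`dY = -(lam - i om) Y dt + σ dW`: it is a centered Gaussian process in `ℂ = ℝ²` with
`E [Y (t + τ) (Y t)ᵀ] = R(τ)` for `τ ≥ 0`. -/
structure IsStationaryOU {Ω : Type*} [MeasurableSpace Ω] (Y : ℝ≥0 → Ω → ℂ) (μ : Measure Ω)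
    (lam om σ : ℝ) : Prop where
  gaussian : IsGaussianProcess Y μ
  centered : ∀ t, ∫ w, Y t w ∂μ = 0
  covariance : ∀ (t τ : ℝ≥0) (a b : Fin 2),
    covariance (fun w => coord a (Y (t + τ) w)) (fun w => coord b (Y t w)) μ =
      covFun lam om σ τ a b

/-- The statistical model `Z t = m + Y t` with constant trend `m`: under `P m lam om` the process
`Z - m` is a stationary complex Ornstein-Uhlenbeck process with damping `lam > 0` and frequency
`om`, normalized so that both coordinates have variance `σ² / (2 lam) = 1`. -/
def IsConstantTrendModel {Ω : Type*} [MeasurableSpace Ω] (Z : ℝ≥0 → Ω → ℂ)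
    (P : ℂ → ℝ → ℝ → Measure Ω) : Prop :=
  ∀ (m : ℂ) (lam om : ℝ), 0 < lam →
    IsStationaryOU (fun t w => Z t w - m) (P m lam om) lam om (Real.sqrt (2 * lam))

/-- The `2n × 2n` covariance matrix `C(n)` of the observations
`Re Z (t 0), Im Z (t 0), …, Re Z (t (n - 1)), Im Z (t (n - 1))`. -/
noncomputable def obsCov {Ω : Type*} [MeasurableSpace Ω] (Z : ℝ≥0 → Ω → ℂ) (μ : Measure Ω)
    {n : ℕ} (t : Fin n → ℝ≥0) : Matrix (Fin n × Fin 2) (Fin n × Fin 2) ℝ :=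
  Matrix.of fun p q =>
    covariance (fun w => coord p.2 (Z (t p.1) w)) (fun w => coord q.2 (Z (t q.1) w)) μ

section Information

variable {Ω : Type*} [MeasurableSpace Ω] (Z : ℝ≥0 → Ω → ℂ) (P : ℂ → ℝ → ℝ → Measure Ω)
  (m : ℂ) (lam om : ℝ) {n : ℕ} (t : Fin n → ℝ≥0)

/-- The entrywise partial derivative of the covariance matrix with respect to the damping. -/
noncomputable def dDamping : Matrix (Fin n × Fin 2) (Fin n × Fin 2) ℝ :=
  Matrix.of fun p q => deriv (fun l => obsCov Z (P m l om) t p q) lam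

/-- The entrywise partial derivative of the covariance matrix with respect to the frequency. -/
noncomputable def dFrequency : Matrix (Fin n × Fin 2) (Fin n × Fin 2) ℝ :=
  Matrix.of fun p q => deriv (fun o => obsCov Z (P m lam o) t p q) om

/-- The Fisher information `½ tr (C⁻¹ ∂C/∂lam C⁻¹ ∂C/∂lam)` on the damping. -/
noncomputable def infoDamping : ℝ :=
  1 / 2 * ((obsCov Z (P m lam om) t)⁻¹ * dDamping Z P m lam om t *
    (obsCov Z (P m lam om) t)⁻¹ * dDamping Z P m lam om t).trace

/-- The Fisher information `½ tr (C⁻¹ ∂C/∂om C⁻¹ ∂C/∂om)` on the frequency. -/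
noncomputable def infoFrequency : ℝ :=
  1 / 2 * ((obsCov Z (P m lam om) t)⁻¹ * dFrequency Z P m lam om t *
    (obsCov Z (P m lam om) t)⁻¹ * dFrequency Z P m lam om t).trace

/-- The mixed entry `½ tr (C⁻¹ ∂C/∂lam C⁻¹ ∂C/∂om)` of the information matrix. -/
noncomputable def infoMixed : ℝ :=
  1 / 2 * ((obsCov Z (P m lam om) t)⁻¹ * dDamping Z P m lam om t *
    (obsCov Z (P m lam om) t)⁻¹ * dFrequency Z P m lam om t).trace

/-- The Fisher information matrix on (damping, frequency). -/
noncomputable def infoMatrix : Matrix (Fin 2) (Fin 2) ℝ :=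
  !![infoDamping Z P m lam om t, infoMixed Z P m lam om t;
    infoMixed Z P m lam om t, infoFrequency Z P m lam om t]

end Information

/-- An admissible `n`-point design: `0 ≤ t 0 < t 1 < … < t (n - 1)`. -/
def IsAdmissible {n : ℕ} (t : Fin n → ℝ≥0) : Prop := StrictMono t

/-- `t` is an admissible `n`-point design that maximizes the criterion `crit` among all admissible
`n`-point designs. -/
def IsOptimalDesign {n : ℕ} (crit : (Fin n → ℝ≥0) → ℝ) (t : Fin n → ℝ≥0) : Prop :=
  IsAdmissible t ∧ ∀ s : Fin n → ℝ≥0, IsAdmissible s → crit s ≤ crit t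

/-- All consecutive points of `t` are at distance `d`. -/
def IsEquidistant {n : ℕ} (t : Fin n → ℝ≥0) (d : ℝ) : Prop :=
  ∀ (j : ℕ) (hj : j + 1 < n),
    (t ⟨j + 1, hj⟩ : ℝ) - (t ⟨j, Nat.lt_of_succ_lt hj⟩ : ℝ) = d

/-- The principal branch of the real Lambert function on `[-1/e, ∞)`: the inverse of the map
`w ↦ w * exp w` restricted to `[-1, ∞)`. -/
noncomputable def lambertW : ℝ → ℝ :=
  Function.invFunOn (fun w : ℝ => w * Real.exp w) (Set.Ici (-1))

end ComplexOU

/-! Write `E` for the real Ornstein–Uhlenbeck covariance matrix with entries exp(-λ|t_i - t_j|), and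
`J` for the generator of plane rotations. Since the rotation by ω(t_i - t_j) splits as a rotation by
ωt_i times one by -ωt_j, the observation covariance is `E ⊗ 1` conjugated by a block rotation. Its
derivatives in λ and ω are `∂E/∂λ ⊗ 1` and `F ⊗ J`, conjugated in the same way, where `F` has
entries (t_i - t_j)E_ij. The rotations therefore cancel in every trace, and the mixed information
vanishes because tr J = 0.

The inverse of `E` is a sum over consecutive pairs (Markov property), so both remaining traces
become sums over the gaps d_j: the informations are 2/λ² times Σ A(λd_j) and Σ B(λd_j), with A =
`dampingGain` and B = `frequencyGain` (`infoDamping_eq`, `infoFrequency_eq`).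

Damping: A(x) < A(x/2), so halving all times improves any design. Frequency: B has a unique
maximizer c, the positive root of 1 - c = exp(-2c), so Σ B is maximal exactly when all λd_j equal c.
Determinant: put K = A(d)/B(d). By the AM-GM inequality, 4K(Σ A)(Σ B) ≤ (Σ(A + KB))², with equality
when all λd_j equal d. For the right d, A + KB is uniquely maximal at that same d
(`supportGain_lt`), which settles the product (`sum_mul_sum_le_and_eq_iff`). -/

namespace ComplexOU

/-! ### The contribution of one gap to the information matrix -/

/-- The contribution to the damping information of a gap of dimensionless length `x`. -/
noncomputable def dampingGain (x : ℝ) : ℝ :=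
  x ^ 2 * (Real.exp (2 * x) + 1) / (Real.exp (2 * x) - 1) ^ 2

/-- The contribution to the frequency information of a gap of dimensionless length `x`. -/
noncomputable def frequencyGain (x : ℝ) : ℝ := x ^ 2 / (Real.exp (2 * x) - 1)

lemma one_lt_exp_two_mul {x : ℝ} (hx : 0 < x) : 1 < Real.exp (2 * x) := by
  rw [Real.one_lt_exp_iff]; linarith

lemma dampingGain_pos {x : ℝ} (hx : 0 < x) : 0 < dampingGain x := by
  have := one_lt_exp_two_mul hx
  have h : 0 < Real.exp (2 * x) - 1 := by linarith
  unfold dampingGain; positivity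

lemma frequencyGain_pos {x : ℝ} (hx : 0 < x) : 0 < frequencyGain x := by
  have := one_lt_exp_two_mul hx
  have h : 0 < Real.exp (2 * x) - 1 := by linarith
  unfold frequencyGain; positivity

/-- With u = exp x, the difference is a positive multiple of (u+1)³ - 4(u²+1) = (u-1)(u²+3). This
comparison alone rules out an optimal design; no monotonicity or limit at 0 is needed. -/
lemma dampingGain_lt_half {x : ℝ} (hx : 0 < x) : dampingGain x < dampingGain (x / 2) := by
  unfold dampingGain
  have hu : 1 < Real.exp x := by rwa [Real.one_lt_exp_iff]
  have e1 : Real.exp (2 * x) = Real.exp x ^ 2 := by rw [← Real.exp_nat_mul]; norm_num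
  have e2 : Real.exp (2 * (x / 2)) = Real.exp x := by congr 1; ring
  rw [e1, e2]
  generalize Real.exp x = u at hu
  have h1 : 0 < u - 1 := by linarith
  have h2 : 0 < u ^ 2 - 1 := by nlinarith
  have : (x / 2) ^ 2 * (u + 1) / (u - 1) ^ 2 - x ^ 2 * (u ^ 2 + 1) / (u ^ 2 - 1) ^ 2 =
      x ^ 2 * ((u - 1) * (u ^ 2 + 3)) / (4 * (u ^ 2 - 1) ^ 2) := by
    field_simp
    ring
  have h3 : 0 < x ^ 2 * ((u - 1) * (u ^ 2 + 3)) / (4 * (u ^ 2 - 1) ^ 2) := by positivity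
  linarith

lemma lt_of_deriv_sign {f f' : ℝ → ℝ} {c : ℝ} (hc : 0 < c)
    (hf : ∀ x, 0 < x → HasDerivAt f (f' x) x) (hpos : ∀ x, 0 < x → x < c → 0 < f' x)
    (hneg : ∀ x, c < x → f' x < 0) {x : ℝ} (hx : 0 < x) (hxc : x ≠ c) : f x < f c := by
  rcases lt_or_gt_of_ne hxc with h | h
  · have : StrictMonoOn f (Set.Ioc 0 c) := by
      refine strictMonoOn_of_deriv_pos (convex_Ioc 0 c)
        (fun y hy => (hf y hy.1).continuousAt.continuousWithinAt) fun y hy => ?_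
      rw [interior_Ioc] at hy
      rw [(hf y hy.1).deriv]
      exact hpos y hy.1 hy.2
    exact this ⟨hx, h.le⟩ ⟨hc, le_rfl⟩ h
  · have : StrictAntiOn f (Set.Ici c) := by
      refine strictAntiOn_of_deriv_neg (convex_Ici c)
        (fun y hy => (hf y (hc.trans_le hy)).continuousAt.continuousWithinAt) fun y hy => ?_
      rw [interior_Ici] at hy
      rw [(hf y (hc.trans hy)).deriv]
      exact hneg y hy
    exact this Set.self_mem_Ici h.le h

lemma hasDerivAt_exp_two_mul (x : ℝ) :
    HasDerivAt (fun y : ℝ => Real.exp (2 * y)) (2 * Real.exp (2 * x)) x := by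
  have := ((hasDerivAt_id x).const_mul 2).exp
  simpa [mul_comm] using this

/-! ### Maximizing the frequency gain -/

lemma exp_neg_two_mul_lt {a b : ℝ} (ha : 0 < a) (hab : a < b) :
    b * Real.exp (-2 * a) < a * Real.exp (-2 * b) + (b - a) := by
  have hb : 0 < b := ha.trans hab
  have h := strictConvexOn_exp.2 (Set.mem_univ (-2 * b)) (Set.mem_univ 0)
    (by intro h; linarith) (div_pos ha hb)
    (show 0 < 1 - a / b by rw [sub_pos, div_lt_one hb]; exact hab) (by ring)
  have e : a / b * (-2 * b) = -2 * a := by field_simp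
  simp only [smul_eq_mul, mul_zero, add_zero, Real.exp_zero, mul_one, e] at h
  calc b * Real.exp (-2 * a) < b * (a / b * Real.exp (-2 * b) + (1 - a / b)) :=
        mul_lt_mul_of_pos_left h hb
    _ = _ := by field_simp

lemma exp_lt_one_sub_of_lt {c x : ℝ} (hc : 1 - c = Real.exp (-2 * c)) (hx : 0 < x) (hxc : x < c) :
    Real.exp (-2 * x) < 1 - x := by
  have h := exp_neg_two_mul_lt hx hxc
  rw [← hc] at h
  exact lt_of_mul_lt_mul_left (by linarith : c * _ < c * (1 - x)) (hx.trans hxc).le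

lemma one_sub_lt_exp_of_lt {c x : ℝ} (hc : 1 - c = Real.exp (-2 * c)) (hc0 : 0 < c) (hxc : c < x) :
    1 - x < Real.exp (-2 * x) := by
  have h := exp_neg_two_mul_lt hc0 hxc
  rw [← hc] at h
  exact lt_of_mul_lt_mul_left (by linarith : c * (1 - x) < c * _) hc0.le

lemma hasDerivAt_frequencyGain {x : ℝ} (hx : 0 < x) :
    HasDerivAt frequencyGain (2 * x * Real.exp (2 * x) / (Real.exp (2 * x) - 1) ^ 2 *
      (1 - x - Real.exp (-2 * x))) x := by
  have hu := one_lt_exp_two_mul hx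
  have h := ((hasDerivAt_id x).pow 2).div ((hasDerivAt_exp_two_mul x).sub_const 1)
    (by linarith)
  refine h.congr_deriv ?_
  have e : Real.exp (-2 * x) = (Real.exp (2 * x))⁻¹ := by rw [← Real.exp_neg]; congr 1; ring
  rw [e]
  have : Real.exp (2 * x) - 1 ≠ 0 := by linarith
  simp only [id, Nat.cast_ofNat, Pi.pow_apply]
  field_simp
  ring

lemma frequencyGain_lt {c x : ℝ} (hc : 1 - c = Real.exp (-2 * c)) (hc0 : 0 < c) (hx : 0 < x)
    (hxc : x ≠ c) : frequencyGain x < frequencyGain c := by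
  refine lt_of_deriv_sign hc0 (fun y hy => hasDerivAt_frequencyGain hy) (fun y hy hyc => ?_)
    (fun y hyc => ?_) hx hxc
  · have := one_lt_exp_two_mul hy
    have h : 0 < Real.exp (2 * y) - 1 := by linarith
    have := exp_lt_one_sub_of_lt hc hy hyc
    exact mul_pos (by positivity) (by linarith)
  · have hy := hc0.trans hyc
    have := one_lt_exp_two_mul hy
    have h : 0 < Real.exp (2 * y) - 1 := by linarith
    have := one_sub_lt_exp_of_lt hc hc0 hyc
    exact mul_neg_of_pos_of_neg (by positivity) (by linarith)

lemma lambertW_spec {x : ℝ} (hx : -Real.exp (-1) ≤ x) (hx0 : x ≤ 0) :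
    -1 ≤ lambertW x ∧ lambertW x * Real.exp (lambertW x) = x := by
  have hex : ∃ w ∈ Set.Ici (-1 : ℝ), w * Real.exp w = x := by
    have hcont : ContinuousOn (fun w : ℝ => w * Real.exp w) (Set.Icc (-1) 0) := by fun_prop
    obtain ⟨w, hw, h⟩ := intermediate_value_Icc (by norm_num) hcont
      (show x ∈ Set.Icc _ _ by simpa using ⟨hx, hx0⟩)
    exact ⟨w, hw.1, h⟩
  exact ⟨Function.invFunOn_mem hex, Function.invFunOn_eq hex⟩

/-- With w = 2c - 2, the equation w·exp w = -2·exp(-2) becomes 1 - c = exp(-2c). The bound w ≥ -1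
discards the other solution w = -2, which gives the trivial root c = 0. -/
lemma frequency_optimum :
    1 - (lambertW (-2 * Real.exp (-2)) / 2 + 1) =
      Real.exp (-2 * (lambertW (-2 * Real.exp (-2)) / 2 + 1)) ∧
    0 < lambertW (-2 * Real.exp (-2)) / 2 + 1 := by
  have h2 : (2 : ℝ) ≤ Real.exp 1 := by linarith [Real.add_one_le_exp (1 : ℝ)]
  have h3 : Real.exp (-1) = Real.exp (-2) * Real.exp 1 := by rw [← Real.exp_add]; norm_num
  obtain ⟨h, e⟩ := lambertW_spec (x := -2 * Real.exp (-2))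
    (by nlinarith [Real.exp_pos (-2)]) (by nlinarith [Real.exp_pos (-2)])
  generalize lambertW (-2 * Real.exp (-2)) = w at h e
  refine ⟨?_, by linarith⟩
  have e1 : Real.exp (-2 * (w / 2 + 1)) = Real.exp (-2) * Real.exp (-w) := by
    rw [← Real.exp_add]; congr 1; ring
  have e2 : Real.exp w * Real.exp (-w) = 1 := by rw [← Real.exp_add]; simp
  rw [e1]
  linear_combination (-1 / 2 * Real.exp (-w)) * e + w / 2 * e2

lemma abs_exp_neg_sub_taylor_le {x : ℝ} (h0 : 0 ≤ x) (h1 : x ≤ 1) :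
    |Real.exp (-x) - ∑ i ∈ Finset.range 12, (-x) ^ i / i.factorial| ≤ 0.00000001 := by
  refine (Real.exp_bound (x := -x) (by rwa [abs_neg, abs_of_nonneg h0]) (n := 12)
    (by norm_num)).trans ?_
  rw [abs_neg, abs_of_nonneg h0]
  -- The remainder after 12 terms is at most 13/(12!·12), about 2.3e-9.
  calc _ ≤ 1 * (((12 : ℕ).succ : ℝ) / ((12 : ℕ).factorial * (12 : ℕ))) := by
        gcongr
        exact pow_le_one₀ h0 h1
    _ ≤ _ := by norm_num [Nat.factorial]

lemma frequency_optimum_approx :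
    |lambertW (-2 * Real.exp (-2)) / 2 + 1 - 0.7968| < 0.00005 := by
  obtain ⟨hc, hc0⟩ := frequency_optimum
  generalize lambertW (-2 * Real.exp (-2)) / 2 + 1 = c at hc hc0
  -- Squaring keeps the Taylor argument within [0, 1].
  have e (y : ℝ) : Real.exp (-2 * y) = Real.exp (-y) ^ 2 := by
    rw [← Real.exp_nat_mul]; congr 1; push_cast; ring
  have hl : (0.79675 : ℝ) < c := by
    by_contra! h
    have key : 1 - (0.79675 : ℝ) ≤ Real.exp (-2 * 0.79675) := by
      rcases h.eq_or_lt with rfl | h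
      · exact hc.le
      · exact (one_sub_lt_exp_of_lt hc hc0 h).le
    have b := abs_le.1 (abs_exp_neg_sub_taylor_le (x := 0.79675) (by norm_num) (by norm_num))
    rw [e] at key
    norm_num [Finset.sum_range_succ, Nat.factorial] at b key
    have hp := Real.exp_pos (-(3187 / 4000))
    nlinarith [b.2]
  have hr : c < (0.79685 : ℝ) := by
    by_contra! h
    have key : Real.exp (-2 * 0.79685) ≤ 1 - (0.79685 : ℝ) := by
      rcases h.eq_or_lt with rfl | h
      · exact hc.ge
      · exact (exp_lt_one_sub_of_lt hc (by norm_num) h).le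
    have b := abs_le.1 (abs_exp_neg_sub_taylor_le (x := 0.79685) (by norm_num) (by norm_num))
    rw [e] at key
    norm_num [Finset.sum_range_succ, Nat.factorial] at b key
    nlinarith [b.1]
  rw [abs_lt]
  constructor <;> linarith

/-! ### Maximizing the determinant -/

/-- The Langevin function `coth x - 1 / x`. -/
noncomputable def langevin (x : ℝ) : ℝ :=
  (Real.exp (2 * x) + 1) / (Real.exp (2 * x) - 1) - 1 / x

/-- The numerator y(exp(2y)+1) - (exp(2y)-1) vanishes at 0, and its derivative is positive because
exp(-2y) > 1 - 2y. -/
lemma langevin_pos {x : ℝ} (hx : 0 < x) : 0 < langevin x := by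
  have hu := one_lt_exp_two_mul hx
  have h1 : 0 < Real.exp (2 * x) - 1 := by linarith
  have hd (y : ℝ) : HasDerivAt (fun y => y * (Real.exp (2 * y) + 1) - (Real.exp (2 * y) - 1))
      (1 + (2 * y - 1) * Real.exp (2 * y)) y := by
    refine (((hasDerivAt_id y).mul ((hasDerivAt_exp_two_mul y).add_const 1)).sub
      ((hasDerivAt_exp_two_mul y).sub_const 1)).congr_deriv ?_
    simp only [id]; ring
  have hmono : StrictMonoOn (fun y => y * (Real.exp (2 * y) + 1) - (Real.exp (2 * y) - 1))
      (Set.Ici 0) := by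
    refine strictMonoOn_of_deriv_pos (convex_Ici 0)
      (fun y _ => (hd y).continuousAt.continuousWithinAt) fun y hy => ?_
    rw [interior_Ici] at hy
    rw [(hd y).deriv]
    have hy : 0 < y := hy
    have h := Real.add_one_lt_exp (x := -2 * y) (by linarith)
    have e : Real.exp (-2 * y) * Real.exp (2 * y) = 1 := by rw [← Real.exp_add]; simp
    nlinarith [mul_lt_mul_of_pos_right h (Real.exp_pos (2 * y))]
  have h := hmono Set.self_mem_Ici hx.le hx
  simp only [mul_zero, Real.exp_zero, zero_mul, sub_self] at h
  unfold langevin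
  rw [div_sub_div _ _ h1.ne' hx.ne']
  refine div_pos ?_ (by positivity)
  linarith

/-- The derivative is 1/y² - 1/sinh² y, which is positive since y < sinh y. -/
lemma langevin_strictMonoOn : StrictMonoOn langevin (Set.Ioi 0) := by
  have hd : ∀ y : ℝ, 0 < y → HasDerivAt langevin
      (1 / y ^ 2 - 4 * Real.exp (2 * y) / (Real.exp (2 * y) - 1) ^ 2) y := by
    intro y hy
    have hu := one_lt_exp_two_mul hy
    have h1 : Real.exp (2 * y) - 1 ≠ 0 := by linarith
    refine ((((hasDerivAt_exp_two_mul y).add_const 1).div ((hasDerivAt_exp_two_mul y).sub_const 1)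
      h1).sub ((hasDerivAt_const y (1 : ℝ)).div (hasDerivAt_id y) hy.ne')).congr_deriv ?_
    simp only [id]
    field_simp
    ring
  refine strictMonoOn_of_deriv_pos (convex_Ioi 0)
    (fun y hy => (hd y hy).continuousAt.continuousWithinAt) fun y hy => ?_
  rw [interior_Ioi] at hy
  have hy : 0 < y := hy
  rw [(hd y hy).deriv]
  have hu := one_lt_exp_two_mul hy
  have h1 : 0 < Real.exp (2 * y) - 1 := by linarith
  have hs := Real.self_lt_sinh_iff.2 hy
  rw [Real.sinh_eq] at hs
  have e1 : Real.exp (2 * y) = Real.exp y ^ 2 := by rw [← Real.exp_nat_mul]; norm_num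
  have e2 : Real.exp (-y) * Real.exp y = 1 := by rw [← Real.exp_add]; simp
  have h2 : 2 * y * Real.exp y < Real.exp (2 * y) - 1 := by
    nlinarith [mul_lt_mul_of_pos_right hs (Real.exp_pos y)]
  have h3 : (2 * y * Real.exp y) ^ 2 < (Real.exp (2 * y) - 1) ^ 2 := by
    have := Real.exp_pos y
    gcongr
  rw [sub_pos, div_lt_div_iff₀ (by positivity) (by positivity)]
  rw [mul_pow, ← e1] at h3
  linarith

/-- The gap criterion that supports the determinant criterion at the gap `log U / 2`. -/
noncomputable def supportGain (U x : ℝ) : ℝ :=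
  x ^ 2 * (U * Real.exp (2 * x) - 1) / (Real.exp (2 * x) - 1) ^ 2

lemma hasDerivAt_supportGain (U : ℝ) {x : ℝ} (hx : 0 < x) :
    HasDerivAt (supportGain U) (2 * x ^ 2 / (Real.exp (2 * x) - 1) ^ 2 *
      (1 - langevin x * (U * Real.exp (2 * x) - 1))) x := by
  have hu := one_lt_exp_two_mul hx
  have h1 : Real.exp (2 * x) - 1 ≠ 0 := by linarith
  have h := (((hasDerivAt_id x).pow 2).mul (((hasDerivAt_exp_two_mul x).const_mul U).sub_const 1)).div
    (((hasDerivAt_exp_two_mul x).sub_const 1).pow 2) (pow_ne_zero 2 h1)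
  refine h.congr_deriv ?_
  simp only [id, Nat.cast_ofNat, Pi.pow_apply, Pi.mul_apply, langevin]
  field_simp
  ring

/-- The sign of the derivative is that of 1 - `langevin x`·(exp(2d)exp(2x) - 1). The subtracted
product has two positive increasing factors and equals 1 at x = d by `hd`, so the sign changes once,
from plus to minus. -/
lemma supportGain_lt {d x : ℝ} (hd0 : 0 < d) (hd : langevin d * (Real.exp (4 * d) - 1) = 1)
    (hx : 0 < x) (hxd : x ≠ d) :
    supportGain (Real.exp (2 * d)) x < supportGain (Real.exp (2 * d)) d := by
  have hU := one_lt_exp_two_mul hd0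
  have e4 : Real.exp (4 * d) = Real.exp (2 * d) * Real.exp (2 * d) := by
    rw [← Real.exp_add]; congr 1; ring
  rw [e4] at hd
  refine lt_of_deriv_sign hd0 (fun y hy => hasDerivAt_supportGain _ hy) (fun y hy hyd => ?_)
    (fun y hyd => ?_) hx hxd
  · have hu := one_lt_exp_two_mul hy
    have h : 0 < Real.exp (2 * y) - 1 := by linarith
    have hL := langevin_strictMonoOn hy hd0 hyd
    have hE : Real.exp (2 * y) < Real.exp (2 * d) := Real.exp_lt_exp.2 (by linarith)
    refine mul_pos (by positivity) ?_
    rw [sub_pos, ← hd]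
    exact mul_lt_mul'' hL (by nlinarith) (langevin_pos hy).le (by nlinarith)
  · have hy := hd0.trans hyd
    have hu := one_lt_exp_two_mul hy
    have h : 0 < Real.exp (2 * y) - 1 := by linarith
    have hL := langevin_strictMonoOn hd0 hy hyd
    have hE : Real.exp (2 * d) < Real.exp (2 * y) := Real.exp_lt_exp.2 (by linarith)
    refine mul_neg_of_pos_of_neg (by positivity) ?_
    rw [sub_neg]
    nth_rewrite 1 [← hd]
    exact mul_lt_mul'' hL (by nlinarith) (langevin_pos hd0).le (by nlinarith)

lemma add_mul_frequencyGain {d x : ℝ} (hd0 : 0 < d) (hx : 0 < x) :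
    dampingGain x + dampingGain d / frequencyGain d * frequencyGain x =
      2 / (Real.exp (2 * d) - 1) * supportGain (Real.exp (2 * d)) x := by
  have hU := one_lt_exp_two_mul hd0
  have hu := one_lt_exp_two_mul hx
  have h1 : Real.exp (2 * x) - 1 ≠ 0 := by linarith
  have h2 : Real.exp (2 * d) - 1 ≠ 0 := by linarith
  unfold dampingGain frequencyGain supportGain
  field_simp
  ring

/-- The right side says that d is critical for its own `supportGain`. In this form the unknown
enters through a product of increasing functions, which yields uniqueness of the root. -/
lemma optimum_equation_iff {d : ℝ} (hd : 0 < d) :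
    1 - d - 2 * d * Real.exp (-2 * d) - Real.exp (-4 * d) = 0 ↔
      langevin d * (Real.exp (4 * d) - 1) = 1 := by
  have hU := one_lt_exp_two_mul hd
  have e4 : Real.exp (4 * d) = Real.exp (2 * d) ^ 2 := by
    rw [← Real.exp_nat_mul]; congr 1; push_cast; ring
  have e2 : Real.exp (-2 * d) = (Real.exp (2 * d))⁻¹ := by rw [← Real.exp_neg]; congr 1; ring
  have e1 : Real.exp (-4 * d) = (Real.exp (2 * d) ^ 2)⁻¹ := by
    rw [← e4, ← Real.exp_neg]; congr 1; ring
  rw [e4, e2, e1]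
  unfold langevin
  generalize Real.exp (2 * d) = u at hU
  have h1 : u - 1 ≠ 0 := by linarith
  have h0 : u ≠ 0 := by linarith
  have key : ((u + 1) / (u - 1) - 1 / d) * (u ^ 2 - 1) - 1 =
      -(u ^ 2 / d) * (1 - d - 2 * d * u⁻¹ - (u ^ 2)⁻¹) := by
    field_simp
    ring
  rw [← sub_eq_zero (b := (1 : ℝ)), key, mul_eq_zero, or_iff_right]
  have : 0 < u ^ 2 / d := by positivity
  linarith

lemma exists_unique_determinant_optimum : ∃ d : ℝ, 0 < d ∧
    1 - d - 2 * d * Real.exp (-2 * d) - Real.exp (-4 * d) = 0 ∧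
    (∀ x : ℝ, 0 < x → 1 - x - 2 * x * Real.exp (-2 * x) - Real.exp (-4 * x) = 0 → x = d) ∧
    |d - 0.4930| < 0.00005 := by
  -- The bracket is 0.4930 ± 0.00005, so the intermediate value theorem supplies the decimal
  -- approximation along with the root.
  have hcont : ContinuousOn
      (fun d : ℝ => 1 - d - 2 * d * Real.exp (-2 * d) - Real.exp (-4 * d))
      (Set.Icc 0.49295 0.49305) := by fun_prop
  have e (y : ℝ) : Real.exp (-4 * y) = Real.exp (-(2 * y)) ^ 2 := by
    rw [← Real.exp_nat_mul]; congr 1; push_cast; ring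
  have h0 : (0 : ℝ) < 1 - 0.49295 - 2 * 0.49295 * Real.exp (-2 * 0.49295)
      - Real.exp (-4 * 0.49295) := by
    have b := abs_le.1 (abs_exp_neg_sub_taylor_le (x := 2 * 0.49295) (by norm_num) (by norm_num))
    rw [e]
    norm_num [Finset.sum_range_succ, Nat.factorial] at b ⊢
    have hp := Real.exp_pos (-(9859 / 10000))
    nlinarith [b.2]
  have h1 : 1 - 0.49305 - 2 * 0.49305 * Real.exp (-2 * 0.49305)
      - Real.exp (-4 * 0.49305) < (0 : ℝ) := by
    have b := abs_le.1 (abs_exp_neg_sub_taylor_le (x := 2 * 0.49305) (by norm_num) (by norm_num))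
    rw [e]
    norm_num [Finset.sum_range_succ, Nat.factorial] at b ⊢
    nlinarith [b.1]
  obtain ⟨d, hd, hdeq⟩ := intermediate_value_Ioo' (by norm_num) hcont (Set.mem_Ioo.2 ⟨h1, h0⟩)
  have hd0 : 0 < d := lt_trans (by norm_num) hd.1
  refine ⟨d, hd0, hdeq, fun x hx hxeq => ?_, ?_⟩
  · have hmono : StrictMonoOn (fun y => langevin y * (Real.exp (4 * y) - 1)) (Set.Ioi 0) := by
      intro a (ha : 0 < a) b hb hab
      have h1 : 1 ≤ Real.exp (4 * a) := Real.one_le_exp (by linarith)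
      exact mul_lt_mul'' (langevin_strictMonoOn ha hb hab)
        (sub_lt_sub_right (Real.exp_lt_exp.2 (by linarith)) 1) (langevin_pos ha).le (by linarith)
    refine hmono.injOn hx hd0 ?_
    exact ((optimum_equation_iff hx).1 hxeq).trans ((optimum_equation_iff hd0).1 hdeq).symm
  · rw [abs_lt]
    constructor <;> linarith [hd.1, hd.2]

/-! ### Exponential covariance matrices and their inverses -/

/-- The covariance matrix of the real stationary Ornstein-Uhlenbeck process at the times `t`. -/
noncomputable def expCov {n : ℕ} (l : ℝ) (t : Fin n → ℝ) : Matrix (Fin n) (Fin n) ℝ :=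
  Matrix.of fun i j => Real.exp (-l * |t i - t j|)

/-- The derivative of `expCov` with respect to the damping. -/
noncomputable def expCovDeriv {n : ℕ} (l : ℝ) (t : Fin n → ℝ) : Matrix (Fin n) (Fin n) ℝ :=
  Matrix.of fun i j => -|t i - t j| * Real.exp (-l * |t i - t j|)

/-- The length of the `j`-th gap of `t`. -/
def gap {k : ℕ} (t : Fin (k + 1) → ℝ) (j : Fin k) : ℝ := t j.succ - t j.castSucc

/-- The precision matrix of the real stationary Ornstein-Uhlenbeck process at the times `t`. -/
noncomputable def expPrec {k : ℕ} (l : ℝ) (t : Fin (k + 1) → ℝ) :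
    Matrix (Fin (k + 1)) (Fin (k + 1)) ℝ :=
  Matrix.single 0 0 1 + ∑ j : Fin k, (1 - Real.exp (-l * gap t j) ^ 2)⁻¹ •
    (Matrix.single j.succ j.succ 1
      - Real.exp (-l * gap t j) •
        (Matrix.single j.succ j.castSucc 1 + Matrix.single j.castSucc j.succ 1)
      + Real.exp (-l * gap t j) ^ 2 • Matrix.single j.castSucc j.castSucc 1)

lemma gap_pos {k : ℕ} {t : Fin (k + 1) → ℝ} (ht : StrictMono t) (j : Fin k) : 0 < gap t j :=
  sub_pos.2 (ht j.castSucc_lt_succ)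

lemma exp_gap_sq_lt_one {l d : ℝ} (hl : 0 < l) (hd : 0 < d) : Real.exp (-l * d) ^ 2 < 1 := by
  have : Real.exp (-l * d) < 1 := by
    rw [Real.exp_lt_one_iff]; nlinarith
  exact pow_lt_one₀ (Real.exp_pos _).le this two_ne_zero

lemma sum_ite_lt_sub {k : ℕ} (f : Fin (k + 1) → ℝ) (i : Fin (k + 1)) :
    ∑ j : Fin k, (if j.castSucc < i then f j.succ - f j.castSucc else 0) = f i - f 0 := by
  induction i using Fin.induction with
  | zero => simp
  | succ i ih =>
    have h (j : Fin k) : (if j.castSucc < i.succ then f j.succ - f j.castSucc else 0) =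
        (if j.castSucc < i.castSucc then f j.succ - f j.castSucc else 0) +
          if j = i then f i.succ - f i.castSucc else 0 := by
      rcases lt_trichotomy j i with h | rfl | h
      · simp [h, h.le, h.ne, Fin.castSucc_lt_succ_iff]
      · simp
      · simp [h.not_ge, h.not_gt, h.ne', Fin.castSucc_lt_succ_iff]
    simp_rw [h, Finset.sum_add_distrib, ih]
    simp

lemma single_mul_apply' {n : Type*} [Fintype n] [DecidableEq n] (a b i k : n)
    (X : Matrix n n ℝ) : (Matrix.single a b (1 : ℝ) * X) i k = if a = i then X b k else 0 := by
  simp [Matrix.mul_apply, Matrix.single_apply, ite_and]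

lemma trace_single_mul' {n : Type*} [Fintype n] [DecidableEq n] (a b : n)
    (X : Matrix n n ℝ) : (Matrix.single a b (1 : ℝ) * X).trace = X b a := by
  simp [Matrix.trace, single_mul_apply']

/-- With ρ the correlation across gap j, the summand of `expPrec` is the outer square of e_{j+1} -
ρe_j divided by 1 - ρ², the variance of the innovation X_{j+1} - ρX_j. Applied to column m of
`expCov`, it gives zero for a gap after m and a telescoping difference for a gap before m. The
initial `single 0 0` cancels the lower end of the telescope. -/
lemma expPrec_mul_expCov {k : ℕ} {l : ℝ} {t : Fin (k + 1) → ℝ} (hl : 0 < l) (ht : StrictMono t) :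
    expPrec l t * expCov l t = 1 := by
  ext i m
  have hedge (j : Fin k) : (((1 - Real.exp (-l * gap t j) ^ 2)⁻¹ •
      (Matrix.single j.succ j.succ 1
        - Real.exp (-l * gap t j) •
          (Matrix.single j.succ j.castSucc 1 + Matrix.single j.castSucc j.succ 1)
        + Real.exp (-l * gap t j) ^ 2 • Matrix.single j.castSucc j.castSucc 1) :
        Matrix (Fin (k + 1)) (Fin (k + 1)) ℝ) * expCov l t) i m =
      if j.castSucc < m then
        (if j.succ = i then expCov l t j.succ m else 0) -
          (if j.castSucc = i then expCov l t j.castSucc m else 0) else 0 := by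
    have hne : 1 - Real.exp (-l * gap t j) ^ 2 ≠ 0 :=
      (sub_pos.2 (exp_gap_sq_lt_one hl (gap_pos ht j))).ne'
    simp only [Matrix.smul_mul, Matrix.add_mul, Matrix.sub_mul, Matrix.smul_apply,
      Matrix.add_apply, Matrix.sub_apply, single_mul_apply', smul_eq_mul]
    by_cases hjm : j.castSucc < m
    · have h1 : t j.succ ≤ t m := ht.monotone (Fin.castSucc_lt_iff_succ_le.1 hjm)
      have h2 : t j.castSucc < t m := ht hjm
      have e : expCov l t j.castSucc m = Real.exp (-l * gap t j) * expCov l t j.succ m := by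
        simp only [expCov, Matrix.of_apply, abs_of_nonpos (sub_nonpos.2 h1),
          abs_of_neg (sub_neg.2 h2), ← Real.exp_add, gap]
        congr 1; ring
      rw [if_pos hjm, e]
      generalize Real.exp (-l * gap t j) = ρ at hne ⊢
      split_ifs <;> field_simp <;> ring
    · have h1 : t m < t j.succ := ht ((not_lt.1 hjm).trans_lt j.castSucc_lt_succ)
      have h2 : t m ≤ t j.castSucc := ht.monotone (not_lt.1 hjm)
      have e : expCov l t j.succ m = Real.exp (-l * gap t j) * expCov l t j.castSucc m := by
        simp only [expCov, Matrix.of_apply, abs_of_nonneg (sub_nonneg.2 h2),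
          abs_of_pos (sub_pos.2 h1), ← Real.exp_add, gap]
        congr 1; ring
      rw [if_neg hjm, e]
      split_ifs <;> ring
  rw [expPrec, Matrix.add_mul, Matrix.add_apply, Finset.sum_mul, Matrix.sum_apply,
    Finset.sum_congr rfl fun j _ => hedge j,
    sum_ite_lt_sub (fun j => if j = i then expCov l t j m else 0) m, single_mul_apply']
  simp only [add_sub_cancel, Matrix.one_apply, eq_comm (a := m)]
  split_ifs with h
  · subst h; simp [expCov]
  · rfl

lemma trace_expPrec_mul {k : ℕ} (l : ℝ) (t : Fin (k + 1) → ℝ)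
    (X : Matrix (Fin (k + 1)) (Fin (k + 1)) ℝ) :
    (expPrec l t * X).trace = X 0 0 + ∑ j : Fin k, (1 - Real.exp (-l * gap t j) ^ 2)⁻¹ *
      (X j.succ j.succ - Real.exp (-l * gap t j) * (X j.castSucc j.succ + X j.succ j.castSucc) +
        Real.exp (-l * gap t j) ^ 2 * X j.castSucc j.castSucc) := by
  simp only [expPrec, Matrix.add_mul, Finset.sum_mul, Matrix.trace_add, Matrix.trace_sum,
    Matrix.smul_mul, Matrix.sub_mul, Matrix.trace_smul, Matrix.trace_sub, trace_single_mul',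
    smul_eq_mul]

lemma abs_gap {k : ℕ} {t : Fin (k + 1) → ℝ} (ht : StrictMono t) (j : Fin k) :
    |t j.succ - t j.castSucc| = gap t j ∧ |t j.castSucc - t j.succ| = gap t j :=
  ⟨abs_of_pos (gap_pos ht j), by rw [abs_sub_comm]; exact abs_of_pos (gap_pos ht j)⟩

lemma gain_conversion {l d : ℝ} (hl : 0 < l) (hd : 0 < d) :
    2 * d ^ 2 * Real.exp (-l * d) ^ 2 * (1 + Real.exp (-l * d) ^ 2) /
        (1 - Real.exp (-l * d) ^ 2) ^ 2 = 2 / l ^ 2 * dampingGain (l * d) ∧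
    2 * d ^ 2 * Real.exp (-l * d) ^ 2 / (1 - Real.exp (-l * d) ^ 2) =
      2 / l ^ 2 * frequencyGain (l * d) := by
  have hu := one_lt_exp_two_mul (mul_pos hl hd)
  have e : Real.exp (-l * d) ^ 2 = (Real.exp (2 * (l * d)))⁻¹ := by
    rw [← Real.exp_nat_mul, ← Real.exp_neg]; congr 1; push_cast; ring
  rw [e]
  unfold dampingGain frequencyGain
  generalize Real.exp (2 * (l * d)) = u at hu
  have h1 : u - 1 ≠ 0 := by linarith
  have h0 : u ≠ 0 := by linarith
  have h2 : 1 - u⁻¹ = (u - 1) / u := by field_simp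
  rw [h2]
  constructor <;> field_simp

lemma hasDerivAt_exp_neg_mul (l d : ℝ) :
    HasDerivAt (fun x => Real.exp (-x * d)) (-d * Real.exp (-l * d)) l := by
  have := (((hasDerivAt_id l).neg).mul_const d).exp
  simpa [mul_comm] using this

/-- Since (E⁻¹)' = -E⁻¹E'E⁻¹, the trace is minus the derivative at x = l of tr(E(x)⁻¹E'(l)), with
the second factor frozen. The frozen factor has zero diagonal and E(x)⁻¹ links only neighbours, so
this function of x is an explicit sum over gaps. -/
lemma trace_prec_deriv_sq {k : ℕ} {l : ℝ} {t : Fin (k + 1) → ℝ} (hl : 0 < l) (ht : StrictMono t) :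
    (expPrec l t * expCovDeriv l t * expPrec l t * expCovDeriv l t).trace =
      2 / l ^ 2 * ∑ j, dampingGain (l * gap t j) := by
  have hdiff (i m) : DifferentiableAt ℝ (fun x => expPrec x t i m) l := by
    simp only [expPrec, Matrix.add_apply, Matrix.sum_apply, Matrix.smul_apply, Matrix.sub_apply,
      smul_eq_mul]
    refine (differentiableAt_const _).add (DifferentiableAt.fun_sum fun j _ => ?_)
    have hne : 1 - Real.exp (-l * gap t j) ^ 2 ≠ 0 :=
      (sub_pos.2 (exp_gap_sq_lt_one hl (gap_pos ht j))).ne'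
    fun_prop (disch := assumption)
  set a' : Matrix (Fin (k + 1)) (Fin (k + 1)) ℝ :=
    Matrix.of fun i m => deriv (fun x => expPrec x t i m) l
  have hprod : a' * expCov l t + expPrec l t * expCovDeriv l t = 0 := by
    ext i m
    have h1 : HasDerivAt (fun x => (expPrec x t * expCov x t) i m)
        ((a' * expCov l t + expPrec l t * expCovDeriv l t) i m) l := by
      simp only [Matrix.mul_apply, Matrix.add_apply, ← Finset.sum_add_distrib]
      exact HasDerivAt.fun_sum fun j _ =>
        (hdiff i j).hasDerivAt.mul (hasDerivAt_exp_neg_mul l |t j - t m|)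
    have h2 : HasDerivAt (fun x => (expPrec x t * expCov x t) i m) 0 l := by
      refine (hasDerivAt_const l ((1 : Matrix _ _ ℝ) i m)).congr_of_eventuallyEq ?_
      filter_upwards [lt_mem_nhds hl] with x hx
      rw [expPrec_mul_expCov hx ht]
    exact h1.unique h2
  have hinv : expCov l t * expPrec l t = 1 := mul_eq_one_comm.1 (expPrec_mul_expCov hl ht)
  have ha : expPrec l t * expCovDeriv l t * expPrec l t = -a' := by
    rw [eq_neg_of_add_eq_zero_right hprod, Matrix.neg_mul, Matrix.mul_assoc, hinv, Matrix.mul_one]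
  rw [ha, Matrix.neg_mul, Matrix.trace_neg]
  have hX : HasDerivAt (fun x => (expPrec x t * expCovDeriv l t).trace)
      ((a' * expCovDeriv l t).trace) l := by
    simp only [Matrix.trace, Matrix.diag, Matrix.mul_apply]
    exact HasDerivAt.fun_sum fun i _ => HasDerivAt.fun_sum fun j _ =>
      (hdiff i j).hasDerivAt.mul_const _
  have hY : HasDerivAt (fun x => (expPrec x t * expCovDeriv l t).trace)
      (-(2 / l ^ 2 * ∑ j, dampingGain (l * gap t j))) l := by
    simp only [trace_expPrec_mul]
    rw [Finset.mul_sum, ← Finset.sum_neg_distrib]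
    refine (HasDerivAt.fun_sum fun j _ => ?_).const_add _
    simp only [expCovDeriv, Matrix.of_apply, abs_gap ht j, sub_self, abs_zero, neg_zero, zero_mul,
      mul_zero, add_zero, zero_sub]
    have hne : 1 - Real.exp (-l * gap t j) ^ 2 ≠ 0 :=
      (sub_pos.2 (exp_gap_sq_lt_one hl (gap_pos ht j))).ne'
    rw [← (gain_conversion hl (gap_pos ht j)).1]
    have hρ := hasDerivAt_exp_neg_mul l (gap t j)
    refine ((((hρ.pow 2).const_sub 1).inv hne).mul ((hρ.mul_const _).neg)).congr_deriv ?_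
    simp only [Pi.pow_apply, Pi.neg_apply, Pi.inv_apply, Nat.cast_ofNat]
    field_simp
    ring
  rw [hX.unique hY, neg_neg]

/-- The derivative of `expCov` with respect to the frequency, up to the generator of rotations. -/
noncomputable def timeDiffCov {n : ℕ} (l : ℝ) (t : Fin n → ℝ) : Matrix (Fin n) (Fin n) ℝ :=
  Matrix.of fun i j => (t i - t j) * Real.exp (-l * |t i - t j|)

/-- With T the diagonal matrix of times, `timeDiffCov` is the commutator [T, E]. Cyclicity of the
trace reduces the quadratic expression to tr(E⁻¹[T, [T, E]]). The double commutator has entries (t_i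
- t_j)²E_ij, of which only those between neighbours contribute. -/
lemma trace_prec_timeDiff_sq {k : ℕ} {l : ℝ} {t : Fin (k + 1) → ℝ} (hl : 0 < l)
    (ht : StrictMono t) :
    (expPrec l t * timeDiffCov l t * expPrec l t * timeDiffCov l t).trace =
      -(2 / l ^ 2 * ∑ j, frequencyGain (l * gap t j)) := by
  set T := Matrix.diagonal t
  set E := expCov l t
  set a := expPrec l t
  have haE : a * E = 1 := expPrec_mul_expCov hl ht
  have hEa : E * a = 1 := mul_eq_one_comm.1 haE
  have hF : timeDiffCov l t = T * E - E * T := by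
    ext i j
    simp [T, E, timeDiffCov, expCov]
    ring
  have hX : (Matrix.of fun i j => (t i - t j) ^ 2 * Real.exp (-l * |t i - t j|)) =
      T * (T * E) - T * E * T - T * E * T + E * T * T := by
    ext i j
    simp [T, E, expCov]
    ring
  have haF : a * timeDiffCov l t = a * (T * E) - T := by
    rw [hF, mul_sub, ← mul_assoc a E T, haE, one_mul]
  have hsq : (a * timeDiffCov l t * a * timeDiffCov l t).trace =
      (a * Matrix.of fun i j => (t i - t j) ^ 2 * Real.exp (-l * |t i - t j|)).trace := by
    rw [mul_assoc (a * timeDiffCov l t), haF, hX]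
    have e1 : (a * (T * E) - T) * (a * (T * E) - T) =
        a * (T * (T * E)) - a * (T * E * T) - T * (a * (T * E)) + T * T := by
      have : a * (T * E) * (a * (T * E)) = a * (T * (T * E)) := by
        calc _ = a * T * (E * a) * (T * E) := by simp only [mul_assoc]
          _ = _ := by rw [hEa, mul_one, mul_assoc]
      rw [sub_mul, mul_sub, mul_sub, this, mul_assoc a (T * E) T, sub_sub_eq_add_sub,
        add_sub_right_comm]
    have e2 : a * (T * (T * E) - T * E * T - T * E * T + E * T * T) =
        a * (T * (T * E)) - a * (T * E * T) - a * (T * E * T) + T * T := by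
      have : a * (E * T * T) = T * T := by
        rw [mul_assoc E, ← mul_assoc a, haE, one_mul]
      rw [mul_add, this, mul_sub, mul_sub]
    rw [e1, e2]
    simp only [Matrix.trace_add, Matrix.trace_sub]
    rw [Matrix.trace_mul_comm T, mul_assoc a]
  rw [hsq, trace_expPrec_mul, Finset.mul_sum, ← Finset.sum_neg_distrib]
  simp only [Matrix.of_apply, sub_self, ne_eq, OfNat.ofNat_ne_zero, not_false_eq_true, zero_pow,
    zero_mul, zero_add, abs_gap ht, mul_zero, add_zero, zero_sub]
  refine Finset.sum_congr rfl fun j _ => ?_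
  rw [← (gain_conversion hl (gap_pos ht j)).2]
  have e : (t j.castSucc - t j.succ) ^ 2 = gap t j ^ 2 := by unfold gap; ring
  have e' : (t j.succ - t j.castSucc) ^ 2 = gap t j ^ 2 := rfl
  rw [e, e']
  ring

/-! ### Matrices of rotated `2 × 2` blocks -/

/-- The rotation of the plane by the angle `θ`. -/
noncomputable def rotation (θ : ℝ) : Matrix (Fin 2) (Fin 2) ℝ :=
  !![Real.cos θ, -Real.sin θ; Real.sin θ, Real.cos θ]

lemma rotation_mul (θ φ : ℝ) : rotation θ * rotation φ = rotation (θ + φ) := by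
  ext i j
  fin_cases i <;> fin_cases j <;>
    simp [rotation, Matrix.mul_apply, Fin.sum_univ_two, Real.cos_add, Real.sin_add] <;> ring

lemma rotation_zero : rotation 0 = 1 := by
  ext i j
  fin_cases i <;> fin_cases j <;> simp [rotation]

/-- The Kronecker product of `A` and `B` conjugated by the block rotation with angles `θ`. -/
noncomputable def rotatedKronecker {n : ℕ} (θ : Fin n → ℝ) (A : Matrix (Fin n) (Fin n) ℝ)
    (B : Matrix (Fin 2) (Fin 2) ℝ) : Matrix (Fin n × Fin 2) (Fin n × Fin 2) ℝ :=
  Matrix.of fun p q => A p.1 q.1 * (rotation (θ p.1) * B * rotation (-θ q.1)) p.2 q.2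

/-- The inner rotations by -θ_j and θ_j cancel, as for any conjugation. -/
lemma rotatedKronecker_mul {n : ℕ} (θ : Fin n → ℝ) (A A' : Matrix (Fin n) (Fin n) ℝ)
    (B B' : Matrix (Fin 2) (Fin 2) ℝ) :
    rotatedKronecker θ A B * rotatedKronecker θ A' B' = rotatedKronecker θ (A * A') (B * B') := by
  ext ⟨i, a⟩ ⟨k, c⟩
  simp only [rotatedKronecker, Matrix.mul_apply (M := Matrix.of _), Matrix.of_apply,
    Fintype.sum_prod_type]
  rw [Matrix.mul_apply, Finset.sum_mul]
  refine Finset.sum_congr rfl fun j _ => ?_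
  have h : rotation (θ i) * (B * B') * rotation (-θ k) =
      rotation (θ i) * B * rotation (-θ j) * (rotation (θ j) * B' * rotation (-θ k)) := by
    calc _ = rotation (θ i) * B * 1 * (B' * rotation (-θ k)) := by simp only [mul_assoc, mul_one]
      _ = rotation (θ i) * B * (rotation (-θ j) * rotation (θ j)) * (B' * rotation (-θ k)) := by
        rw [rotation_mul, neg_add_cancel, rotation_zero]
      _ = _ := by simp only [mul_assoc]
  rw [h, Matrix.mul_apply (N := rotation (θ j) * B' * rotation (-θ k)), Finset.mul_sum]
  exact Finset.sum_congr rfl fun b _ => by ring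

lemma rotatedKronecker_one {n : ℕ} (θ : Fin n → ℝ) : rotatedKronecker θ 1 1 = 1 := by
  ext ⟨i, a⟩ ⟨k, c⟩
  by_cases h : i = k
  · subst h
    simp [rotatedKronecker, rotation_mul, rotation_zero, Matrix.one_apply, Prod.ext_iff]
  · simp [rotatedKronecker, Matrix.one_apply, h, Prod.ext_iff]

lemma trace_rotatedKronecker {n : ℕ} (θ : Fin n → ℝ) (A : Matrix (Fin n) (Fin n) ℝ)
    (B : Matrix (Fin 2) (Fin 2) ℝ) :
    (rotatedKronecker θ A B).trace = A.trace * B.trace := by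
  have h (i : Fin n) : (rotation (θ i) * B * rotation (-θ i)).trace = B.trace := by
    rw [Matrix.trace_mul_comm, ← Matrix.mul_assoc, rotation_mul, neg_add_cancel, rotation_zero,
      Matrix.one_mul]
  simp only [Matrix.trace, Matrix.diag, rotatedKronecker, Matrix.of_apply,
    Fintype.sum_prod_type, ← Finset.mul_sum] at h ⊢
  rw [Finset.sum_mul]
  exact Finset.sum_congr rfl fun i _ => by rw [h]

/-- The generator of rotations of the plane. -/
def rotationGenerator : Matrix (Fin 2) (Fin 2) ℝ := !![0, -1; 1, 0]

lemma rotatedKronecker_eq {n : ℕ} (o : ℝ) (t : Fin n → ℝ) (A : Matrix (Fin n) (Fin n) ℝ) (p q) :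
    rotatedKronecker (fun i => o * t i) A 1 p q =
      A p.1 q.1 * rotation (o * (t p.1 - t q.1)) p.2 q.2 := by
  simp only [rotatedKronecker, Matrix.of_apply, Matrix.mul_one, rotation_mul, mul_add,
    sub_eq_add_neg, mul_neg]

lemma hasDerivAt_rotation (o s : ℝ) (a b : Fin 2) :
    HasDerivAt (fun x => rotation (x * s) a b) (s * (rotation (o * s) * rotationGenerator) a b)
      o := by
  have hm : HasDerivAt (fun x : ℝ => x * s) s o := by simpa using (hasDerivAt_id o).mul_const s
  have hc := hm.cos
  have hs := hm.sin
  fin_cases a <;> fin_cases b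
  · exact hc.congr_deriv (by simp [rotation, rotationGenerator, Matrix.mul_apply]; ring)
  · exact hs.neg.congr_deriv (by simp [rotation, rotationGenerator, Matrix.mul_apply]; ring)
  · exact hs.congr_deriv (by simp [rotation, rotationGenerator, Matrix.mul_apply]; ring)
  · exact hc.congr_deriv (by simp [rotation, rotationGenerator, Matrix.mul_apply]; ring)

lemma rotationGenerator_commute (θ : ℝ) :
    rotationGenerator * rotation θ = rotation θ * rotationGenerator := by
  ext i j
  fin_cases i <;> fin_cases j <;> simp [rotation, rotationGenerator, Matrix.mul_apply]

lemma rotatedKronecker_generator_eq {n : ℕ} (o : ℝ) (t : Fin n → ℝ)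
    (A : Matrix (Fin n) (Fin n) ℝ) (p q) :
    rotatedKronecker (fun i => o * t i) A rotationGenerator p q =
      A p.1 q.1 * (rotation (o * (t p.1 - t q.1)) * rotationGenerator) p.2 q.2 := by
  simp only [rotatedKronecker, Matrix.of_apply]
  rw [Matrix.mul_assoc, rotationGenerator_commute, ← Matrix.mul_assoc, rotation_mul,
    mul_sub, sub_eq_add_neg]

/-! ### The information matrix of the model -/

lemma coord_sub (a : Fin 2) (z w : ℂ) : coord a (z - w) = coord a z - coord a w := by
  fin_cases a <;> simp [coord]

section

variable {Ω : Type*} [MeasurableSpace Ω] {Z : ℝ≥0 → Ω → ℂ} {P : ℂ → ℝ → ℝ → Measure Ω}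

lemma IsStationaryOU.integrable_coord {Y : ℝ≥0 → Ω → ℂ} {μ : Measure Ω} {lam om σ : ℝ}
    (h : IsStationaryOU Y μ lam om σ) (a : Fin 2) (t : ℝ≥0) :
    Integrable (fun w => coord a (Y t w)) μ := by
  have hi : Integrable (Y t) μ := (h.gaussian.hasGaussianLaw_eval t).integrable
  fin_cases a
  · exact hi.re
  · exact hi.im

lemma covFun_sqrt {lam : ℝ} (hlam : 0 < lam) (om τ : ℝ) (a b : Fin 2) :
    covFun lam om (Real.sqrt (2 * lam)) τ a b = Real.exp (-lam * τ) * rotation (om * τ) a b := by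
  have h : Real.sqrt (2 * lam) ^ 2 / (2 * lam) = 1 := by
    rw [Real.sq_sqrt (by positivity), div_self (by positivity)]
  rw [covFun, h, one_mul, Matrix.smul_apply, smul_eq_mul, rotation]

lemma rotation_neg_apply (θ : ℝ) (a b : Fin 2) : rotation (-θ) a b = rotation θ b a := by
  fin_cases a <;> fin_cases b <;> simp [rotation]

lemma IsConstantTrendModel.covariance_coord (hP : IsConstantTrendModel Z P) (m : ℂ) {lam : ℝ}
    (hlam : 0 < lam) (om : ℝ) (s t : ℝ≥0) (a b : Fin 2) :
    covariance (fun w => coord a (Z s w)) (fun w => coord b (Z t w)) (P m lam om) =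
      Real.exp (-lam * |(s : ℝ) - t|) * rotation (om * (s - t)) a b := by
  have h := hP m lam om hlam
  have := h.gaussian.isProbabilityMeasure
  have hshift (s t : ℝ≥0) (a b : Fin 2) :
      covariance (fun w => coord a (Z s w)) (fun w => coord b (Z t w)) (P m lam om) =
      covariance (fun w => coord a (Z s w - m)) (fun w => coord b (Z t w - m)) (P m lam om) := by
    have e (c : Fin 2) (r : ℝ≥0) :
        (fun w => coord c (Z r w)) = fun w => coord c (Z r w - m) + coord c m := by
      ext w; rw [coord_sub]; ring
    rw [e a s, e b t, covariance_add_const_left (h.integrable_coord a s),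
      covariance_add_const_right (h.integrable_coord b t)]
  have key (s t : ℝ≥0) (hst : t ≤ s) (a b : Fin 2) :
      covariance (fun w => coord a (Z s w)) (fun w => coord b (Z t w)) (P m lam om) =
      Real.exp (-lam * |(s : ℝ) - t|) * rotation (om * (s - t)) a b := by
    have hc := h.covariance t (s - t) a b
    rw [add_tsub_cancel_of_le hst, covFun_sqrt hlam, NNReal.coe_sub hst] at hc
    rw [hshift, hc, abs_of_nonneg (sub_nonneg.2 (NNReal.coe_le_coe.2 hst))]
  rcases le_total t s with hst | hst
  · exact key s t hst a b
  -- Reversed time order: swapping the arguments transposes the block, and the transpose of a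
  -- rotation is the rotation by the opposite angle.
  · rw [covariance_comm, key t s hst b a, abs_sub_comm, ← rotation_neg_apply]
    congr 2
    ring

lemma IsConstantTrendModel.obsCov_eq (hP : IsConstantTrendModel Z P) (m : ℂ) {lam : ℝ}
    (hlam : 0 < lam) (om : ℝ) {n : ℕ} (t : Fin n → ℝ≥0) :
    obsCov Z (P m lam om) t =
      rotatedKronecker (fun i => om * (t i : ℝ)) (expCov lam fun i => (t i : ℝ)) 1 := by
  ext p q
  rw [rotatedKronecker_eq om (fun i => (t i : ℝ)), obsCov, Matrix.of_apply,
    hP.covariance_coord m hlam, expCov, Matrix.of_apply]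

lemma IsConstantTrendModel.dDamping_eq (hP : IsConstantTrendModel Z P) (m : ℂ) {lam : ℝ}
    (hlam : 0 < lam) (om : ℝ) {n : ℕ} (t : Fin n → ℝ≥0) :
    dDamping Z P m lam om t =
      rotatedKronecker (fun i => om * (t i : ℝ)) (expCovDeriv lam fun i => (t i : ℝ)) 1 := by
  ext p q
  rw [rotatedKronecker_eq om (fun i => (t i : ℝ)), dDamping, Matrix.of_apply]
  refine HasDerivAt.deriv (HasDerivAt.congr_of_eventuallyEq
    ((hasDerivAt_exp_neg_mul lam |(t p.1 : ℝ) - t q.1|).mul_const _) ?_)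
  -- The model prescribes covariances only for positive damping, so the closed form is available
  -- only near `lam`.
  filter_upwards [lt_mem_nhds hlam] with l hl
  exact hP.covariance_coord m hl om _ _ _ _

lemma IsConstantTrendModel.dFrequency_eq (hP : IsConstantTrendModel Z P) (m : ℂ) {lam : ℝ}
    (hlam : 0 < lam) (om : ℝ) {n : ℕ} (t : Fin n → ℝ≥0) :
    dFrequency Z P m lam om t =
      rotatedKronecker (fun i => om * (t i : ℝ)) (timeDiffCov lam fun i => (t i : ℝ))
        rotationGenerator := by
  ext p q
  rw [rotatedKronecker_generator_eq om (fun i => (t i : ℝ)), dFrequency, Matrix.of_apply]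
  have h := (hasDerivAt_rotation om ((t p.1 : ℝ) - t q.1) p.2 q.2).const_mul
    (Real.exp (-lam * |(t p.1 : ℝ) - t q.1|))
  have hf : (fun o => obsCov Z (P m lam o) t p q) = fun o =>
      Real.exp (-lam * |(t p.1 : ℝ) - t q.1|) * rotation (o * ((t p.1 : ℝ) - t q.1)) p.2 q.2 := by
    ext o
    exact hP.covariance_coord m hlam o _ _ _ _
  rw [hf, h.deriv, timeDiffCov, Matrix.of_apply]
  ring

lemma IsConstantTrendModel.obsCov_inv (hP : IsConstantTrendModel Z P) (m : ℂ) {lam : ℝ}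
    (hlam : 0 < lam) (om : ℝ) {k : ℕ} {t : Fin (k + 1) → ℝ≥0} (ht : StrictMono t) :
    (obsCov Z (P m lam om) t)⁻¹ =
      rotatedKronecker (fun i => om * (t i : ℝ)) (expPrec lam fun i => (t i : ℝ)) 1 := by
  refine Matrix.inv_eq_left_inv ?_
  rw [hP.obsCov_eq m hlam, rotatedKronecker_mul,
    expPrec_mul_expCov (t := fun i => (t i : ℝ)) hlam fun _ _ h => NNReal.coe_lt_coe.2 (ht h),
    mul_one, rotatedKronecker_one]

lemma IsConstantTrendModel.infoDamping_eq (hP : IsConstantTrendModel Z P) (m : ℂ) {lam : ℝ}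
    (hlam : 0 < lam) (om : ℝ) {k : ℕ} {t : Fin (k + 1) → ℝ≥0} (ht : StrictMono t) :
    infoDamping Z P m lam om t =
      2 / lam ^ 2 * ∑ j, dampingGain (lam * gap (fun i => (t i : ℝ)) j) := by
  rw [infoDamping, hP.obsCov_inv m hlam om ht, hP.dDamping_eq m hlam]
  simp only [rotatedKronecker_mul, trace_rotatedKronecker, mul_one, Matrix.trace_one]
  rw [trace_prec_deriv_sq (t := fun i => (t i : ℝ)) hlam fun _ _ h => NNReal.coe_lt_coe.2 (ht h)]
  norm_num
  ring

lemma IsConstantTrendModel.infoFrequency_eq (hP : IsConstantTrendModel Z P) (m : ℂ) {lam : ℝ}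
    (hlam : 0 < lam) (om : ℝ) {k : ℕ} {t : Fin (k + 1) → ℝ≥0} (ht : StrictMono t) :
    infoFrequency Z P m lam om t =
      2 / lam ^ 2 * ∑ j, frequencyGain (lam * gap (fun i => (t i : ℝ)) j) := by
  have hJ : (rotationGenerator * rotationGenerator).trace = -2 := by
    simp [rotationGenerator, Matrix.trace, Fin.sum_univ_two]; norm_num
  rw [infoFrequency, hP.obsCov_inv m hlam om ht, hP.dFrequency_eq m hlam]
  simp only [rotatedKronecker_mul, trace_rotatedKronecker, mul_one, one_mul, hJ]
  rw [trace_prec_timeDiff_sq (t := fun i => (t i : ℝ)) hlam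
    fun _ _ h => NNReal.coe_lt_coe.2 (ht h)]
  ring

lemma IsConstantTrendModel.infoMixed_eq_zero (hP : IsConstantTrendModel Z P) (m : ℂ) {lam : ℝ}
    (hlam : 0 < lam) (om : ℝ) {k : ℕ} {t : Fin (k + 1) → ℝ≥0} (ht : StrictMono t) :
    infoMixed Z P m lam om t = 0 := by
  have hJ : rotationGenerator.trace = 0 := by simp [rotationGenerator, Matrix.trace]
  rw [infoMixed, hP.obsCov_inv m hlam om ht, hP.dDamping_eq m hlam, hP.dFrequency_eq m hlam]
  simp only [rotatedKronecker_mul, trace_rotatedKronecker, mul_one, one_mul, hJ, mul_zero]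

lemma IsConstantTrendModel.det_infoMatrix_eq (hP : IsConstantTrendModel Z P) (m : ℂ) {lam : ℝ}
    (hlam : 0 < lam) (om : ℝ) {k : ℕ} {t : Fin (k + 1) → ℝ≥0} (ht : StrictMono t) :
    (infoMatrix Z P m lam om t).det = (2 / lam ^ 2) ^ 2 *
      ((∑ j, dampingGain (lam * gap (fun i => (t i : ℝ)) j)) *
        ∑ j, frequencyGain (lam * gap (fun i => (t i : ℝ)) j)) := by
  rw [infoMatrix, Matrix.det_fin_two_of, hP.infoDamping_eq m hlam om ht,
    hP.infoFrequency_eq m hlam om ht, hP.infoMixed_eq_zero m hlam om ht]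
  ring

end

/-! ### Optimal designs -/

lemma isEquidistant_iff {k : ℕ} (t : Fin (k + 1) → ℝ≥0) (d : ℝ) :
    IsEquidistant t d ↔ ∀ j, gap (fun i => (t i : ℝ)) j = d :=
  ⟨fun h j => h j (Nat.succ_lt_succ j.2), fun h j hj => h ⟨j, Nat.lt_of_succ_lt_succ hj⟩⟩

lemma exists_equidistant (k : ℕ) {d : ℝ} (hd : 0 < d) :
    ∃ t : Fin (k + 1) → ℝ≥0, IsAdmissible t ∧ ∀ j, gap (fun i => (t i : ℝ)) j = d := by
  lift d to ℝ≥0 using hd.le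
  refine ⟨fun i => (i : ℕ) * d, fun i j hij => ?_, fun j => ?_⟩
  · exact mul_lt_mul_of_pos_right (Nat.cast_lt.2 hij) (NNReal.coe_pos.1 hd)
  · simp only [gap, Fin.val_succ, Fin.val_castSucc]
    push_cast
    ring

/-- If a criterion depends only on the gaps and its value is uniquely maximal when all gaps equal
`d`, then the optimal designs are the equidistant ones with gap `d`. -/
lemma isOptimalDesign_iff_isEquidistant {k : ℕ} {crit : (Fin (k + 1) → ℝ≥0) → ℝ} {d M : ℝ}
    (hd : 0 < d)
    (hle : ∀ s, IsAdmissible s → crit s ≤ M)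
    (heq : ∀ s, IsAdmissible s → (crit s = M ↔ ∀ j, gap (fun i => (s i : ℝ)) j = d))
    {t : Fin (k + 1) → ℝ≥0} (ht : IsAdmissible t) :
    IsOptimalDesign crit t ↔ IsEquidistant t d := by
  rw [isEquidistant_iff, ← heq t ht]
  refine ⟨fun h => ?_, fun h => ⟨ht, fun s hs => h ▸ hle s hs⟩⟩
  -- An equidistant design attains `M`, so every optimal design must attain it too.
  obtain ⟨s, hs, hsd⟩ := exists_equidistant k hd
  exact (hle t ht).antisymm ((heq s hs).2 hsd ▸ h.2 s hs)

lemma sum_le_and_eq_iff {ι : Type*} [Fintype ι] {f : ℝ → ℝ} {c : ℝ}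
    (hf : ∀ x, 0 < x → x ≠ c → f x < f c) {x : ι → ℝ} (hx : ∀ j, 0 < x j) :
    ∑ j, f (x j) ≤ ∑ _j : ι, f c ∧ (∑ j, f (x j) = ∑ _j : ι, f c ↔ ∀ j, x j = c) := by
  have hle : ∀ j ∈ Finset.univ, f (x j) ≤ f c := fun j _ => by
    by_cases h : x j = c
    · rw [h]
    · exact (hf _ (hx j) h).le
  refine ⟨Finset.sum_le_sum hle, ?_⟩
  rw [Finset.sum_eq_sum_iff_of_le hle]
  refine ⟨fun h j => ?_, fun h j _ => by rw [h j]⟩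
  by_contra hne
  exact (hf _ (hx j) hne).ne (h j (Finset.mem_univ j))

lemma sum_mul_sum_le_and_eq_iff {ι : Type*} [Fintype ι] {d : ℝ} (hd0 : 0 < d)
    (hd : langevin d * (Real.exp (4 * d) - 1) = 1) {x : ι → ℝ} (hx : ∀ j, 0 < x j) :
    (∑ j, dampingGain (x j)) * ∑ j, frequencyGain (x j) ≤
      (∑ _j : ι, dampingGain d) * ∑ _j : ι, frequencyGain d ∧
    ((∑ j, dampingGain (x j)) * ∑ j, frequencyGain (x j) =
      (∑ _j : ι, dampingGain d) * ∑ _j : ι, frequencyGain d ↔ ∀ j, x j = d) := by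
  -- This weight balances the two sums at gap d, so that AM-GM is an equality there.
  set K := dampingGain d / frequencyGain d with hK
  have hB := frequencyGain_pos hd0
  have hKpos : 0 < K := div_pos (dampingGain_pos hd0) hB
  have hA : dampingGain d = K * frequencyGain d := by rw [hK]; field_simp
  have hU := one_lt_exp_two_mul hd0
  have hc : 0 < 2 / (Real.exp (2 * d) - 1) := div_pos two_pos (by linarith)
  obtain ⟨hle, heq⟩ := sum_le_and_eq_iff (f := fun y => dampingGain y + K * frequencyGain y)
    (c := d) (fun y hy hyd => by
      simp only [hK]
      rw [add_mul_frequencyGain hd0 hy, add_mul_frequencyGain hd0 hd0]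
      exact mul_lt_mul_of_pos_left (supportGain_lt hd0 hd hy hyd) hc) hx
  simp only [Finset.sum_add_distrib, ← Finset.mul_sum] at hle heq
  have hSA : ∑ _j : ι, dampingGain d = K * ∑ _j : ι, frequencyGain d := by
    rw [Finset.mul_sum, hA]
  have h1 : 0 ≤ ∑ j, dampingGain (x j) :=
    Finset.sum_nonneg fun j _ => (dampingGain_pos (hx j)).le
  have h2 : 0 ≤ ∑ j, frequencyGain (x j) :=
    Finset.sum_nonneg fun j _ => (frequencyGain_pos (hx j)).le
  have h3 : 0 ≤ ∑ _j : ι, frequencyGain d := Finset.sum_nonneg fun j _ => hB.le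
  have heq' : (∀ j, x j = d) → (∑ j, dampingGain (x j)) * ∑ j, frequencyGain (x j) =
      (∑ _j : ι, dampingGain d) * ∑ _j : ι, frequencyGain d := fun h => by simp only [h]
  rw [hSA] at hle heq heq' ⊢
  generalize ∑ j, dampingGain (x j) = a at *
  generalize ∑ j, frequencyGain (x j) = b at *
  generalize ∑ _j : ι, frequencyGain d = c at *
  have hb := mul_nonneg hKpos.le h2
  have hs : (a + K * b) ^ 2 ≤ (K * c + K * c) ^ 2 := by gcongr
  refine ⟨?_, fun h => heq.1 ?_, heq'⟩
  -- AM-GM as 4Kab = (a + Kb)² - (a - Kb)², combined with a + Kb ≤ 2Kc.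
  · refine le_of_mul_le_mul_left ?_ hKpos
    nlinarith [sq_nonneg (a - K * b)]
  -- If ab = Kc², the same identity gives (2Kc)² ≤ (a + Kb)². The weighted sum is then maximal,
  -- which forces all gaps to equal d.
  · refine hle.antisymm (abs_le_of_sq_le_sq' ?_ (add_nonneg h1 hb)).2
    nlinarith [sq_nonneg (a - K * b)]

end ComplexOU

theorem theorem3 {Ω : Type*} [MeasurableSpace Ω] (Z : ℝ≥0 → Ω → ℂ) (P : ℂ → ℝ → ℝ → Measure Ω)
    (hP : ComplexOU.IsConstantTrendModel Z P) (m : ℂ) (lam om : ℝ) (hlam : 0 < lam) (hom : om ≠ 0)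
    (n : ℕ) (hn : 2 ≤ n) :
    (¬ ∃ t : Fin n → ℝ≥0,
      ComplexOU.IsOptimalDesign (ComplexOU.infoDamping Z P m lam om) t) ∧
    ((∀ t : Fin n → ℝ≥0, ComplexOU.IsAdmissible t →
        (ComplexOU.IsOptimalDesign (ComplexOU.infoFrequency Z P m lam om) t ↔
          ComplexOU.IsEquidistant t
            (1 / lam * (ComplexOU.lambertW (-2 * Real.exp (-2)) / 2 + 1)))) ∧
      |ComplexOU.lambertW (-2 * Real.exp (-2)) / 2 + 1 - 0.7968| < 0.00005) ∧
    (∃ d : ℝ, 0 < d ∧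
      1 - d - 2 * d * Real.exp (-2 * d) - Real.exp (-4 * d) = 0 ∧
      (∀ x : ℝ, 0 < x → 1 - x - 2 * x * Real.exp (-2 * x) - Real.exp (-4 * x) = 0 → x = d) ∧
      |d - 0.4930| < 0.00005 ∧
      ∀ t : Fin n → ℝ≥0, ComplexOU.IsAdmissible t →
        (ComplexOU.IsOptimalDesign (fun s => (ComplexOU.infoMatrix Z P m lam om s).det) t ↔
          ComplexOU.IsEquidistant t (d / lam))) := by
  open ComplexOU in
  obtain ⟨k, rfl⟩ : ∃ k, n = k + 1 := ⟨n - 1, by omega⟩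
  have hgap {s : Fin (k + 1) → ℝ≥0} (hs : IsAdmissible s) (j : Fin k) :
      0 < gap (fun i => (s i : ℝ)) j :=
    gap_pos (t := fun i => (s i : ℝ)) (fun _ _ h => NNReal.coe_lt_coe.2 (hs h)) j
  have hscale {s : Fin (k + 1) → ℝ≥0} (hs : IsAdmissible s) (j : Fin k) :
      0 < lam * gap (fun i => (s i : ℝ)) j := mul_pos hlam (hgap hs j)
  have hc : 0 < 2 / lam ^ 2 := by positivity
  refine ⟨?_, ⟨fun t ht => ?_, frequency_optimum_approx⟩, ?_⟩
  · rintro ⟨t, ht, hmax⟩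
    have hs : IsAdmissible fun i => t i / 2 := fun i j h => by
      exact div_lt_div_of_pos_right (ht h) two_pos
    have := hmax _ hs
    rw [hP.infoDamping_eq m hlam om ht, hP.infoDamping_eq m hlam om hs] at this
    have hlt : ∑ j, dampingGain (lam * gap (fun i => (t i : ℝ)) j) <
        ∑ j, dampingGain (lam * gap (fun i => ((t i / 2 : ℝ≥0) : ℝ)) j) := by
      -- At least two points means at least one gap, which makes the inequality between the sums
      -- strict.
      refine Finset.sum_lt_sum_of_nonempty ⟨⟨0, by omega⟩, Finset.mem_univ _⟩ fun j _ => ?_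
      refine (dampingGain_lt_half (hscale ht j)).trans_eq ?_
      congr 1
      simp only [gap]
      push_cast
      ring
    exact absurd this (not_le.2 (mul_lt_mul_of_pos_left hlt hc))
  · obtain ⟨hopt, hpos⟩ := frequency_optimum
    generalize lambertW (-2 * Real.exp (-2)) / 2 + 1 = c at hopt hpos
    have hmain {s : Fin (k + 1) → ℝ≥0} (hs : IsAdmissible s) :=
      sum_le_and_eq_iff (f := frequencyGain) (fun x hx hxc => frequencyGain_lt hopt hpos hx hxc) (hscale hs)
    refine isOptimalDesign_iff_isEquidistant (M := 2 / lam ^ 2 * ∑ _j : Fin k, frequencyGain c)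
      (by positivity) (fun s hs => ?_) (fun s hs => ?_) ht
    · rw [hP.infoFrequency_eq m hlam om hs]
      exact mul_le_mul_of_nonneg_left (hmain hs).1 hc.le
    · rw [hP.infoFrequency_eq m hlam om hs, mul_right_inj' hc.ne', (hmain hs).2]
      refine forall_congr' fun j => ?_
      rw [one_div_mul_eq_div, eq_div_iff hlam.ne', mul_comm]
  · obtain ⟨d, hd0, hd, huniq, happrox⟩ := exists_unique_determinant_optimum
    refine ⟨d, hd0, hd, huniq, happrox, fun t ht => ?_⟩
    have hmain {s : Fin (k + 1) → ℝ≥0} (hs : IsAdmissible s) :=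
      sum_mul_sum_le_and_eq_iff hd0 ((optimum_equation_iff hd0).1 hd) (hscale hs)
    refine isOptimalDesign_iff_isEquidistant (M := (2 / lam ^ 2) ^ 2 *
      ((∑ _j : Fin k, dampingGain d) * ∑ _j : Fin k, frequencyGain d))
      (by positivity) (fun s hs => ?_) (fun s hs => ?_) ht
    · rw [hP.det_infoMatrix_eq m hlam om hs]
      exact mul_le_mul_of_nonneg_left (hmain hs).1 (by positivity)
    · rw [hP.det_infoMatrix_eq m hlam om hs, mul_right_inj' (by positivity), (hmain hs).2]
      refine forall_congr' fun j => ?_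
      rw [eq_div_iff hlam.ne', mul_comm]
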